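/- Let $N\ge 0$, let $\mathbf R\in\mathbb C^{N\times N}$ be Hermitian positive semidefinite, and let $\mathbf h\sim\mathcal{CN}(\mathbf 0,\mathbf R)$, i.e. $\mathbf h$ is a random vector in $\mathbb C^N$ distributed as $\mathbf R^{1/2}\tilde{\mathbf h}$, where $\tilde{\mathbf h}\sim\mathcal{CN}(\mathbf 0,\mathbf I)$ has i.i.d. coordinates whose real and imaginary parts are independent real Gaussians with mean $0$ and variance $1/2$. Let $p>0$ and $\sigma>0$. Let $r=\operatorname{rank}\mathbf R$, let $\lambda_1,\dots,\lambda_r>0$ be the positive eigenvalues of $\mathbf R$ counted with multiplicity, and let $\lambda_{\min}=\min_i\lambda_i$ (if $\mathbf R=\mathbf 0$, the value assigned to $\lambda_{\min}$ is immaterial: the series below has only zero terms and both sides are $0$). Define $\psi_0=1$ and recursively, for $k\ge 0$, $$\psi_{k+1}=\sum_{i=1}^{k+1}\Bigl[\sum_{j=1}^{r}\Bigl(1-\frac{\lambda_{\min}}{\lambda_j}\Bigr)^{i}\Bigr]\frac{\psi_{k+1-i}}{k+1},$$ put $a=\frac{p}{\sigma^2}\lambda_{\min}$, and let $\mathrm{Ei}(x)=-\int_{-x}^{\infty}e^{-t}t^{-1}\,dt$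 for $x<0$. Then $\log_2\bigl(1+\frac{p}{\sigma^2}\lVert\mathbf h\rVert^2\bigr)$ is integrable, the series over $k$ below converges absolutely, and the ergodic channel capacity is $$\mathbb E\Bigl[\log_2\Bigl(1+\frac{p}{\sigma^2}\lVert\mathbf h\rVert^2\Bigr)\Bigr]=\frac{\lambda_{\min}^{r}}{\prod_{i=1}^{r}\lambda_i}\sum_{k=0}^{\infty}\sum_{\mu=0}^{r+k-1}\frac{\psi_k/\ln 2}{(r+k-1-\mu)!}\left[\frac{(-1)^{r+k-\mu}e^{1/a}}{a^{\,r+k-1-\mu}}\,\mathrm{Ei}\Bigl(-\frac1a\Bigr)+\sum_{u=1}^{r+k-1-\mu}(u-1)!\Bigl(-\frac1a\Bigr)^{r+k-1-\mu-u}\right].$$ -/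

import Mathlib

open MeasureTheory ProbabilityTheory
open scoped ComplexOrder MatrixOrder

noncomputable section

namespace RayleighECC

/-- The scalar distribution `CN(0,1)`: real and imaginary parts are independent real Gaussians
with mean `0` and variance `1/2`. -/
def stdComplexGaussian : Measure ℂ :=
  ((gaussianReal 0 (1 / 2)).prod (gaussianReal 0 (1 / 2))).map
    (fun z : ℝ × ℝ => (z.1 : ℂ) + (z.2 : ℂ) * Complex.I)

/-- The distribution `CN(0, I)` on `ℂ ^ N`: independent `CN(0,1)` coordinates. -/
def stdComplexGaussianVec (N : ℕ) : Measure (EuclideanSpace ℂ (Fin N)) :=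
  (Measure.pi (fun _ : Fin N => stdComplexGaussian)).map (WithLp.toLp 2)

/-- The distribution `CN(m, R)` on `ℂ ^ N`, for `R` positive semidefinite: the law of
`m + R^{1/2} z` with `z ∼ CN(0, I)`, where `R^{1/2}` is the positive semidefinite square root. -/
def complexGaussian {N : ℕ} (m : EuclideanSpace ℂ (Fin N)) (R : Matrix (Fin N) (Fin N) ℂ) :
    Measure (EuclideanSpace ℂ (Fin N)) :=
  (stdComplexGaussianVec N).map
    (fun z => m + Matrix.toEuclideanCLM (𝕜 := ℂ) (CFC.sqrt R) z)

/-- The exponential integral `Ei(x) = - ∫_{-x}^∞ e^{-t} t^{-1} dt`, for `x < 0`. -/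
def Ei (x : ℝ) : ℝ := -∫ t in Set.Ioi (-x), Real.exp (-t) * t⁻¹

variable {N : ℕ} {R : Matrix (Fin N) (Fin N) ℂ}

/-- The indices of the positive eigenvalues of `R`, so that the positive eigenvalues, listed with
multiplicity, are `hR.eigenvalues j` for `j ∈ posEig hR`. -/
def posEig (hR : R.IsHermitian) : Finset (Fin N) :=
  Finset.univ.filter (fun j => 0 < hR.eigenvalues j)

/-- The smallest positive eigenvalue of `R` (the value for `R = 0`, where there is none, is `0`;
it is immaterial). -/
def lambdaMin (hR : R.IsHermitian) : ℝ := sInf (hR.eigenvalues '' (posEig hR : Set (Fin N)))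

/-- If `R` has a positive eigenvalue, `lambdaMin` is the least one. -/
theorem isLeast_lambdaMin (hR : R.IsHermitian) (h : (posEig hR).Nonempty) :
    IsLeast (hR.eigenvalues '' (posEig hR : Set (Fin N))) (lambdaMin hR) := by
  have hfin : (hR.eigenvalues '' (posEig hR : Set (Fin N))).Finite :=
    (posEig hR).finite_toSet.image _
  have hne : (hR.eigenvalues '' (posEig hR : Set (Fin N))).Nonempty :=
    (Finset.coe_nonempty.2 h).image _
  exact ⟨hne.csInf_mem hfin, fun _ hx => csInf_le hfin.bddBelow hx⟩

/-- The coefficients `ψ_k`, defined recursively. -/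
def psi (hR : R.IsHermitian) : ℕ → ℝ
  | 0 => 1
  | k + 1 => ∑ i : Fin (k + 1),
      (∑ j ∈ posEig hR, (1 - lambdaMin hR / hR.eigenvalues j) ^ ((i : ℕ) + 1)) *
        (psi hR (k - i) / ((k : ℝ) + 1))
decreasing_by omega

theorem psi_zero (hR : R.IsHermitian) : psi hR 0 = 1 := by
  rw [psi]

/-- The recursion for `ψ_k` with the summation index running from `1` to `k + 1`. -/
theorem psi_succ (hR : R.IsHermitian) (k : ℕ) :
    psi hR (k + 1) = ∑ i ∈ Finset.Icc 1 (k + 1),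
      (∑ j ∈ posEig hR, (1 - lambdaMin hR / hR.eigenvalues j) ^ i) *
        (psi hR (k + 1 - i) / ((k : ℝ) + 1)) := by
  rw [psi, Finset.sum_fin_eq_sum_range, Finset.range_eq_Ico,
    show Finset.Icc 1 (k + 1) = Finset.Ico (0 + 1) (k + 1 + 1) from rfl,
    ← Finset.sum_Ico_add']
  refine Finset.sum_congr rfl fun i hi => ?_
  rw [dif_pos (Finset.mem_Ico.1 hi).2, Nat.add_sub_add_right]

/-- The `k`-th term of the outer series, where `r` is the rank of `R` and `a = (p/σ²) λ_min`. -/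
def eccTerm (hR : R.IsHermitian) (p σ : ℝ) (k : ℕ) : ℝ :=
  let r := R.rank
  let a := p / σ ^ 2 * lambdaMin hR
  ∑ μ ∈ Finset.range (r + k),
    psi hR k / Real.log 2 / ((r + k - 1 - μ).factorial : ℝ) *
      ((-1) ^ (r + k - μ) * Real.exp (1 / a) / a ^ (r + k - 1 - μ) * Ei (-1 / a) +
        ∑ u ∈ Finset.Icc 1 (r + k - 1 - μ),
          ((u - 1).factorial : ℝ) * (-1 / a) ^ (r + k - 1 - μ - u))

end RayleighECC

end

noncomputable section

namespace RayleighECC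

/-! Unitary invariance of `CN(0, I)` diagonalises the problem: `‖h‖²` has the law of `∑ λ_j |w_j|²`
with `w ∼ CN(0, I)`, so its characteristic function is `∏ (1 - itλ_j)⁻¹` over the positive
eigenvalues (`charFun_map_norm_sq_complexGaussian`). Rescale by `β = λ_min` and put `z = (1 -
it)⁻¹`, `q_j = 1 - β/λ_j ∈ [0, 1)`. Each rescaled factor equals `(β/λ_j) z (1 - q_j z)⁻¹`. Since
`|z| ≤ 1`, the product `∏ (1 - q_j z)⁻¹` expands as `∑ ψ_k z^k`; the recursion for `ψ` is Newton's
identity for complete homogeneous symmetric functions (`psi_eq_coeff_geomProd`). As `z^(r+k)` is the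
characteristic function of the Erlang law of shape `r + k`, the law of `‖h‖²/β` is a mixture of
Erlang laws with weights `(β^r/∏ λ_j) ψ_k` (`map_inv_lambdaMin_mul_norm_sq`). The capacity is then
integrated component by component. For one Erlang law, integration by parts against its tail reduces
the logarithm to elementary integrals and `Ei` (`integral_log_one_add_mul_erlang`). Integrability
over the whole mixture, which follows from `log (1 + x) ≤ x` and a finite first moment, gives
absolute convergence of the series. -/

/-! ### The law `CN(0, I)`: unitary invariance and the transform of `|w|²`. -/

theorem measurable_re_add_im_mul_I :
    Measurable fun z : ℝ × ℝ => (z.1 : ℂ) + (z.2 : ℂ) * Complex.I := by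
  fun_prop

instance : IsProbabilityMeasure stdComplexGaussian :=
  Measure.isProbabilityMeasure_map measurable_re_add_im_mul_I.aemeasurable

instance (N : ℕ) : IsProbabilityMeasure (stdComplexGaussianVec N) :=
  Measure.isProbabilityMeasure_map (by fun_prop)

theorem charFun_stdComplexGaussian (t : ℂ) :
    charFun stdComplexGaussian t = Complex.exp (-((‖t‖ ^ 2 / 4 : ℝ) : ℂ)) := by
  have h : ∀ z : ℝ × ℝ, Complex.exp
      (((inner ℝ ((z.1 : ℂ) + (z.2 : ℂ) * Complex.I) t : ℝ) : ℂ) * Complex.I) =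
      Complex.exp (t.re * z.1 * Complex.I) * Complex.exp (t.im * z.2 * Complex.I) := by
    intro z
    rw [← Complex.exp_add, Complex.inner]
    congr 1
    simp
    ring
  rw [charFun_apply, stdComplexGaussian,
    integral_map measurable_re_add_im_mul_I.aemeasurable (by fun_prop)]
  simp_rw [h]
  rw [integral_prod_mul (fun x : ℝ => Complex.exp (t.re * x * Complex.I))
    (fun x : ℝ => Complex.exp (t.im * x * Complex.I)), ← charFun_apply_real,
    ← charFun_apply_real, charFun_gaussianReal, charFun_gaussianReal, ← Complex.exp_add,
    Complex.sq_norm, Complex.normSq_apply]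
  congr 1
  push_cast
  ring

theorem charFun_stdComplexGaussianVec {N : ℕ} (t : EuclideanSpace ℂ (Fin N)) :
    charFun (stdComplexGaussianVec N) t = Complex.exp (-((‖t‖ ^ 2 / 4 : ℝ) : ℂ)) := by
  rw [stdComplexGaussianVec, charFun_pi]
  simp_rw [charFun_stdComplexGaussian]
  rw [← Complex.exp_sum, EuclideanSpace.norm_sq_eq, Finset.sum_div]
  push_cast
  rw [Finset.sum_neg_distrib]

/-- The law `CN(0, I)` is unitarily invariant. -/
theorem map_linearIsometryEquiv_stdComplexGaussianVec {N : ℕ}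
    (U : EuclideanSpace ℂ (Fin N) ≃ₗᵢ[ℝ] EuclideanSpace ℂ (Fin N)) :
    (stdComplexGaussianVec N).map U = stdComplexGaussianVec N := by
  have hU : Measurable U := U.continuous.measurable
  have : IsProbabilityMeasure ((stdComplexGaussianVec N).map U) :=
    Measure.isProbabilityMeasure_map hU.aemeasurable
  refine Measure.ext_of_charFun (funext fun t => ?_)
  rw [charFun_apply, integral_map hU.aemeasurable (by fun_prop)]
  -- The isometry moves to the test vector as its inverse, and the characteristic function depends
  -- only on the norm of that vector.
  simp_rw [LinearIsometryEquiv.inner_map_eq_flip]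
  rw [← charFun_apply, charFun_stdComplexGaussianVec, charFun_stdComplexGaussianVec,
    LinearIsometryEquiv.norm_map]

/-- Variance `1/2` makes the density `π^(-1/2) exp (-x²)`, so this is a Gaussian integral with
parameter `1 - c`. Complex `c` is needed because characteristic functions use it at purely imaginary
values. -/
theorem integral_gaussianReal_half_cexp_mul_sq {c : ℂ} (hc : c.re < 1) :
    ∫ x, Complex.exp (c * x ^ 2) ∂(gaussianReal 0 (1 / 2)) =
      (√Real.pi)⁻¹ * (Real.pi / (1 - c)) ^ (1 / 2 : ℂ) := by
  rw [integral_gaussianReal_eq_integral_smul (by norm_num),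
    ← integral_gaussian_complex (by simpa using hc), ← integral_const_mul]
  congr 1
  ext x
  rw [gaussianPDFReal, Complex.real_smul]
  push_cast
  rw [mul_assoc, ← Complex.exp_add]
  congr 2
  · rw [show 2 * Real.pi * (1 / 2) = Real.pi by ring]
  · ring

theorem integral_stdComplexGaussian_cexp_mul_normSq {c : ℂ} (hc : c.re < 1) :
    ∫ w, Complex.exp (c * ((‖w‖ ^ 2 : ℝ) : ℂ)) ∂stdComplexGaussian = (1 - c)⁻¹ := by
  have h : ∀ z : ℝ × ℝ,
      Complex.exp (c * ((‖(z.1 : ℂ) + (z.2 : ℂ) * Complex.I‖ ^ 2 : ℝ) : ℂ)) =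
      Complex.exp (c * (z.1 : ℂ) ^ 2) * Complex.exp (c * (z.2 : ℂ) ^ 2) := by
    intro z
    rw [← Complex.exp_add, Complex.sq_norm, Complex.normSq_apply]
    congr 1
    simp
    ring
  have hc' : (1 : ℂ) - c ≠ 0 := fun h0 => by
    have := congrArg Complex.re h0
    simp at this
    linarith
  rw [stdComplexGaussian,
    integral_map measurable_re_add_im_mul_I.aemeasurable (by fun_prop)]
  simp_rw [h]
  rw [integral_prod_mul (fun x : ℝ => Complex.exp (c * (x : ℂ) ^ 2))
    (fun x : ℝ => Complex.exp (c * (x : ℂ) ^ 2)), integral_gaussianReal_half_cexp_mul_sq hc]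
  have hpi : (Real.pi : ℂ) ≠ 0 := by exact_mod_cast Real.pi_ne_zero
  have h1 : ((√Real.pi : ℝ) : ℂ) * (√Real.pi : ℝ) = Real.pi := by
    rw [← Complex.ofReal_mul, Real.mul_self_sqrt Real.pi_pos.le]
  -- Both factors are the same principal root, so adding exponents over one nonzero base raises no
  -- branch question.
  have h2 : ((Real.pi : ℂ) / (1 - c)) ^ (1 / 2 : ℂ) * (Real.pi / (1 - c)) ^ (1 / 2 : ℂ) =
      Real.pi / (1 - c) := by
    rw [← Complex.cpow_add _ _ (div_ne_zero hpi hc')]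
    norm_num
  rw [mul_mul_mul_comm, h2, Complex.ofReal_inv, ← mul_inv, h1]
  field_simp

theorem integrable_normSq_stdComplexGaussian :
    Integrable (fun w : ℂ => ‖w‖ ^ 2) stdComplexGaussian := by
  have h2 : Integrable (fun x : ℝ => x ^ 2) (gaussianReal 0 (1 / 2)) := by
    simpa using (memLp_id_gaussianReal (μ := 0) (v := 1 / 2) 2).integrable_sq
  rw [stdComplexGaussian, integrable_map_measure (by fun_prop)
    measurable_re_add_im_mul_I.aemeasurable]
  refine ((h2.comp_fst (gaussianReal 0 (1 / 2))).add
    (h2.comp_snd (gaussianReal 0 (1 / 2)))).congr (Filter.Eventually.of_forall fun z => ?_)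
  simp [Complex.sq_norm, Complex.normSq_apply]
  ring

/-! ### The law of `‖h‖²` in eigenvector coordinates. -/

variable {N : ℕ} {R : Matrix (Fin N) (Fin N) ℂ}

theorem inner_eigenvectorBasis_toEuclideanCLM (hR : R.IsHermitian) (j : Fin N)
    (z : EuclideanSpace ℂ (Fin N)) :
    inner ℂ (hR.eigenvectorBasis j) (Matrix.toEuclideanCLM (𝕜 := ℂ) R z) =
      hR.eigenvalues j * inner ℂ (hR.eigenvectorBasis j) z := by
  have hsa : IsSelfAdjoint (Matrix.toEuclideanCLM (𝕜 := ℂ) R) :=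
    hR.isSelfAdjoint.map (Matrix.toEuclideanCLM (𝕜 := ℂ))
  have hv : Matrix.toEuclideanCLM (𝕜 := ℂ) R (hR.eigenvectorBasis j) =
      (hR.eigenvalues j : ℂ) • hR.eigenvectorBasis j := by
    ext i
    have := congrFun (hR.mulVec_eigenvectorBasis j) i
    simpa using this
  have := hsa.isSymmetric (hR.eigenvectorBasis j) z
  simp only [ContinuousLinearMap.coe_coe] at this
  rw [← this, hv, inner_smul_left, Complex.conj_ofReal]

/-- The square root is self-adjoint, so the left side is `⟨z, R z⟩`; expand it in the eigenbasis of
`R`. -/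
theorem norm_sq_toEuclideanCLM_sqrt (hR : R.PosSemidef) (z : EuclideanSpace ℂ (Fin N)) :
    ‖Matrix.toEuclideanCLM (𝕜 := ℂ) (CFC.sqrt R) z‖ ^ 2 =
      ∑ j, hR.isHermitian.eigenvalues j * ‖hR.isHermitian.eigenvectorBasis.repr z j‖ ^ 2 := by
  have hsq : Matrix.toEuclideanCLM (𝕜 := ℂ) (CFC.sqrt R)
      (Matrix.toEuclideanCLM (𝕜 := ℂ) (CFC.sqrt R) z) = Matrix.toEuclideanCLM (𝕜 := ℂ) R z := by
    rw [← mul_apply_eq_comp, ← map_mul, CFC.sqrt_mul_sqrt_self R hR.nonneg]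
  have hsa : IsSelfAdjoint (Matrix.toEuclideanCLM (𝕜 := ℂ) (CFC.sqrt R)) :=
    (CFC.sqrt_nonneg R).isSelfAdjoint.map (Matrix.toEuclideanCLM (𝕜 := ℂ))
  have h1 := hsa.isSymmetric z (Matrix.toEuclideanCLM (𝕜 := ℂ) (CFC.sqrt R) z)
  simp only [ContinuousLinearMap.coe_coe] at h1
  rw [hsq, inner_self_eq_norm_sq_to_K,
    ← hR.isHermitian.eigenvectorBasis.sum_inner_mul_inner] at h1
  simp_rw [inner_eigenvectorBasis_toEuclideanCLM] at h1
  have h2 : ∀ j, inner ℂ z (hR.isHermitian.eigenvectorBasis j) *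
      (hR.isHermitian.eigenvalues j * inner ℂ (hR.isHermitian.eigenvectorBasis j) z) =
      ((hR.isHermitian.eigenvalues j * ‖hR.isHermitian.eigenvectorBasis.repr z j‖ ^ 2 : ℝ) : ℂ) := by
    intro j
    rw [mul_left_comm, OrthonormalBasis.repr_apply_apply, ← inner_conj_symm z,
      Complex.conj_mul']
    push_cast
    rfl
  simp_rw [h2] at h1
  rw [← Complex.ofReal_sum] at h1
  apply Complex.ofReal_injective
  rw [Complex.ofReal_pow]
  exact h1

/-- The law of `‖h‖²` for `h ∼ CN(0, R)` is that of `∑ λ_j |w_j|²` with `w ∼ CN(0, I)`. -/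
theorem map_norm_sq_complexGaussian (hR : R.PosSemidef) :
    (complexGaussian 0 R).map (fun z => ‖z‖ ^ 2) =
      (Measure.pi fun _ : Fin N => stdComplexGaussian).map
        (fun w => ∑ j, hR.isHermitian.eigenvalues j * ‖w j‖ ^ 2) := by
  let b := hR.isHermitian.eigenvectorBasis
  -- Eigenbasis coordinates, viewed as a real-linear isometry to match the invariance statement.
  let U : EuclideanSpace ℂ (Fin N) ≃ₗᵢ[ℝ] EuclideanSpace ℂ (Fin N) :=
    { b.repr.toLinearEquiv.restrictScalars ℝ with norm_map' := b.repr.norm_map }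
  rw [complexGaussian, Measure.map_map (by fun_prop) (by fun_prop)]
  have hcomp : (fun z : EuclideanSpace ℂ (Fin N) => ‖z‖ ^ 2) ∘
      (fun z => 0 + Matrix.toEuclideanCLM (𝕜 := ℂ) (CFC.sqrt R) z) =
      (fun z : EuclideanSpace ℂ (Fin N) =>
        ∑ j, hR.isHermitian.eigenvalues j * ‖z j‖ ^ 2) ∘ U := by
    ext z
    simp only [Function.comp_apply, zero_add]
    exact norm_sq_toEuclideanCLM_sqrt hR z
  rw [hcomp, ← Measure.map_map (by fun_prop) U.continuous.measurable,
    map_linearIsometryEquiv_stdComplexGaussianVec, stdComplexGaussianVec,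
    Measure.map_map (by fun_prop) (by fun_prop)]
  rfl

theorem integrable_id_map_norm_sq_complexGaussian (hR : R.PosSemidef) :
    Integrable (fun x : ℝ => x) ((complexGaussian 0 R).map (fun z => ‖z‖ ^ 2)) := by
  rw [map_norm_sq_complexGaussian hR, integrable_map_measure (by fun_prop)
    (Finset.measurable_sum _ fun j _ => by fun_prop).aemeasurable]
  exact integrable_finsetSum _ fun j _ =>
    (integrable_comp_eval (X := fun _ => ℂ) (i := j) (f := fun w : ℂ => ‖w‖ ^ 2)
      integrable_normSq_stdComplexGaussian).const_mul _

theorem charFun_map_norm_sq_complexGaussian (hR : R.PosSemidef) (t : ℝ) :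
    charFun ((complexGaussian 0 R).map (fun z => ‖z‖ ^ 2)) t =
      ∏ j ∈ posEig hR.isHermitian, (1 - t * Complex.I * hR.isHermitian.eigenvalues j)⁻¹ := by
  rw [charFun_apply_real, map_norm_sq_complexGaussian hR,
    integral_map (Finset.measurable_sum _ fun j _ => by fun_prop).aemeasurable (by fun_prop)]
  have h : ∀ w : Fin N → ℂ, Complex.exp
      (t * ((∑ j, hR.isHermitian.eigenvalues j * ‖w j‖ ^ 2 : ℝ) : ℂ) * Complex.I) =
      ∏ j, Complex.exp (t * Complex.I * hR.isHermitian.eigenvalues j * ((‖w j‖ ^ 2 : ℝ) : ℂ)) := by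
    intro w
    rw [← Complex.exp_sum]
    congr 1
    push_cast
    rw [Finset.mul_sum, Finset.sum_mul]
    exact Finset.sum_congr rfl fun j _ => by ring
  simp_rw [h]
  rw [integral_fintype_prod_eq_prod (𝕜 := ℂ) (fun (j : Fin N) (w : ℂ) =>
    Complex.exp (t * Complex.I * hR.isHermitian.eigenvalues j * ((‖w‖ ^ 2 : ℝ) : ℂ)))]
  rw [posEig, Finset.prod_filter]
  refine Finset.prod_congr rfl fun j _ => ?_
  rw [integral_stdComplexGaussian_cexp_mul_normSq (by simp)]
  -- A zero eigenvalue contributes the factor `1`, so only positive ones remain.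
  split_ifs with hj
  · rfl
  · rw [le_antisymm (not_lt.1 hj) (hR.eigenvalues_nonneg j)]
    simp

theorem card_posEig (hR : R.PosSemidef) : (posEig hR.isHermitian).card = R.rank := by
  rw [hR.isHermitian.rank_eq_card_non_zero_eigs, Fintype.card_subtype, posEig]
  congr 1
  ext j
  simp [(hR.eigenvalues_nonneg j).lt_iff_ne, eq_comm]

/-! ### Erlang laws and their characteristic functions. -/

/-- The standard gamma distribution with integer shape parameter `n + 1`. -/
def erlang (n : ℕ) : Measure ℝ :=
  (volume.restrict (Set.Ioi 0)).withDensity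
    fun y => ENNReal.ofReal (y ^ n / n.factorial * Real.exp (-y))

theorem integrableOn_pow_mul_exp_neg (n : ℕ) :
    IntegrableOn (fun y : ℝ => y ^ n * Real.exp (-y)) (Set.Ioi 0) := by
  refine (Real.GammaIntegral_convergent (s := (n : ℝ) + 1) (by positivity)).congr_fun
    (fun y _ => ?_) measurableSet_Ioi
  simp [mul_comm]

theorem integrableOn_erlangDensity (n : ℕ) :
    IntegrableOn (fun y : ℝ => y ^ n / n.factorial * Real.exp (-y)) (Set.Ioi 0) :=
  ((integrableOn_pow_mul_exp_neg n).div_const (n.factorial : ℝ)).congr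
    (Filter.Eventually.of_forall fun y => by ring)

instance (n : ℕ) : IsFiniteMeasure (erlang n) :=
  isFiniteMeasure_withDensity_ofReal (integrableOn_erlangDensity n).2

theorem integral_erlang {E : Type*} [NormedAddCommGroup E] [NormedSpace ℝ E] (n : ℕ)
    (g : ℝ → E) :
    ∫ y, g y ∂(erlang n) =
      ∫ y in Set.Ioi 0, (y ^ n / n.factorial * Real.exp (-y)) • g y := by
  rw [erlang, integral_withDensity_eq_integral_toReal_smul (by fun_prop) (by simp)]
  refine setIntegral_congr_fun measurableSet_Ioi fun y (hy : 0 < y) => ?_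
  rw [ENNReal.toReal_ofReal (by positivity)]

theorem integrableOn_pow_mul_cexp {s : ℂ} (hs : s.re = 1) (n : ℕ) :
    IntegrableOn (fun y : ℝ => (y : ℂ) ^ n * Complex.exp (-s * y)) (Set.Ioi 0) := by
  refine (integrableOn_pow_mul_exp_neg n).mono' (by fun_prop) ?_
  filter_upwards [ae_restrict_mem measurableSet_Ioi] with y hy
  rw [norm_mul, norm_pow, Complex.norm_real, Complex.norm_exp, Real.norm_of_nonneg (le_of_lt hy)]
  simp [hs]

/-- Integrating the derivative of `y^(n+1) exp (-s y)` over the half-line gives `s I_(n+1) = (n+1)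
I_n`. -/
theorem integral_pow_mul_cexp {s : ℂ} (hs : s.re = 1) (n : ℕ) :
    ∫ y : ℝ in Set.Ioi 0, (y : ℂ) ^ n * Complex.exp (-s * y) = n.factorial * s⁻¹ ^ (n + 1) := by
  have hs0 : s ≠ 0 := by rintro rfl; simp at hs
  induction n with
  | zero =>
    simp_rw [pow_zero, one_mul]
    rw [integral_exp_mul_complex_Ioi (by simp [hs])]
    simp
  | succ n ih =>
    have hd : ∀ y ∈ Set.Ioi (0 : ℝ), HasDerivAt
        (fun y : ℝ => (y : ℂ) ^ (n + 1) * Complex.exp (-s * y))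
        ((n + 1 : ℂ) * ((y : ℂ) ^ n * Complex.exp (-s * y)) -
          s * ((y : ℂ) ^ (n + 1) * Complex.exp (-s * y))) y := by
      intro y _
      have h1 : HasDerivAt (fun y : ℂ => y ^ (n + 1) * Complex.exp (-s * y))
          (((n + 1 : ℕ) : ℂ) * (y : ℂ) ^ n * Complex.exp (-s * y) +
            (y : ℂ) ^ (n + 1) * (Complex.exp (-s * y) * (-s))) (y : ℂ) := by
        exact ((hasDerivAt_pow (n + 1) (y : ℂ)).mul
          (((hasDerivAt_id (y : ℂ)).const_mul (-s)).cexp)).congr_deriv (by simp)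
      refine h1.comp_ofReal.congr_deriv ?_
      push_cast
      ring
    have hi1 := (integrableOn_pow_mul_cexp hs n).const_mul (n + 1 : ℂ)
    have hi2 := (integrableOn_pow_mul_cexp hs (n + 1)).const_mul s
    have hlim : Filter.Tendsto (fun y : ℝ => (y : ℂ) ^ (n + 1) * Complex.exp (-s * y))
        Filter.atTop (nhds 0) := by
      rw [tendsto_zero_iff_norm_tendsto_zero]
      refine (Real.tendsto_pow_mul_exp_neg_atTop_nhds_zero (n + 1)).congr' ?_
      filter_upwards [Filter.eventually_gt_atTop 0] with y hy
      rw [norm_mul, norm_pow, Complex.norm_real, Complex.norm_exp, Real.norm_of_nonneg hy.le]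
      simp [hs]
    have := integral_Ioi_of_hasDerivAt_of_tendsto (Continuous.continuousWithinAt (by fun_prop))
      hd (hi1.sub hi2) hlim
    rw [integral_sub hi1 hi2, integral_const_mul, integral_const_mul, ih] at this
    simp only [Complex.ofReal_zero, ne_eq, Nat.add_eq_zero_iff, one_ne_zero, and_false,
      not_false_eq_true, zero_pow, zero_mul, sub_zero] at this
    rw [sub_eq_zero] at this
    rw [Nat.factorial_succ, pow_succ (s⁻¹), ← mul_right_inj' hs0, ← this]
    push_cast
    field_simp

theorem charFun_erlang (n : ℕ) (t : ℝ) :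
    charFun (erlang n) t = (1 - t * Complex.I)⁻¹ ^ (n + 1) := by
  have hn : (n.factorial : ℂ) ≠ 0 := by exact_mod_cast n.factorial_ne_zero
  rw [charFun_apply_real, integral_erlang, ← mul_right_inj' hn,
    ← integral_pow_mul_cexp (s := 1 - t * Complex.I) (by simp), ← integral_const_mul]
  congr 1
  ext y
  rw [Complex.real_smul]
  push_cast
  rw [show -(1 - t * Complex.I) * y = -(y : ℂ) + t * y * Complex.I by ring, Complex.exp_add]
  field_simp

instance (n : ℕ) : IsProbabilityMeasure (erlang n) := by
  -- The total mass is the characteristic function at `0`.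
  have h : (((erlang n).real Set.univ : ℝ) : ℂ) = 1 := by
    rw [← charFun_zero, charFun_erlang]
    simp
  refine ⟨?_⟩
  rw [← ENNReal.toReal_eq_one_iff]
  exact_mod_cast h

/-! ### The mean of `log (1 + a y)` under an Erlang law. -/

/-- Substitute `t = y + 1/a` in the integral defining `Ei`. -/
theorem integral_Ioi_exp_neg_mul_div {a : ℝ} (ha : 0 < a) :
    ∫ y in Set.Ioi 0, a / (1 + a * y) * Real.exp (-y) = -(Real.exp (1 / a) * Ei (-1 / a)) := by
  have h := (measurePreserving_add_right volume (1 / a)).setIntegral_preimage_emb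
    (measurableEmbedding_addRight (1 / a)) (fun t : ℝ => Real.exp (-t) * t⁻¹) (Set.Ioi (1 / a))
  rw [Set.preimage_add_const_Ioi, sub_self] at h
  rw [Ei, mul_neg, neg_neg, neg_div, neg_neg, ← h, ← integral_const_mul]
  refine setIntegral_congr_fun measurableSet_Ioi fun y (hy : 0 < y) => ?_
  rw [neg_add, Real.exp_add, Real.exp_neg (1 / a)]
  have := Real.exp_pos (1 / a)
  field_simp
  ring

theorem integrableOn_div_mul_pow_mul_exp_neg {a : ℝ} (ha : 0 < a) (m : ℕ) :
    IntegrableOn (fun y => a / (1 + a * y) * (y ^ m * Real.exp (-y))) (Set.Ioi 0) := by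
  refine ((integrableOn_pow_mul_exp_neg m).const_mul a).mono' (by fun_prop) ?_
  filter_upwards [ae_restrict_mem measurableSet_Ioi] with y (hy : 0 < y)
  rw [Real.norm_of_nonneg (by positivity)]
  gcongr
  exact div_le_self ha.le (by nlinarith)

theorem integral_pow_mul_exp_neg (n : ℕ) :
    ∫ y : ℝ in Set.Ioi 0, y ^ n * Real.exp (-y) = n.factorial := by
  rw [← Real.Gamma_nat_eq_factorial, Real.Gamma_eq_integral (by positivity)]
  refine setIntegral_congr_fun measurableSet_Ioi fun y _ => ?_
  simp [mul_comm]

/-- Since `a y/(1 + a y) = 1 - 1/(1 + a y)`, these integrals satisfy `J_(m+1) = m! - J_m/a`, and the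
right side unrolls this recursion. -/
theorem integral_Ioi_div_mul_pow_mul_exp_neg {a : ℝ} (ha : 0 < a) (m : ℕ) :
    ∫ y in Set.Ioi 0, a / (1 + a * y) * (y ^ m * Real.exp (-y)) =
      (-1) ^ (m + 1) * Real.exp (1 / a) / a ^ m * Ei (-1 / a) +
        ∑ u ∈ Finset.Icc 1 m, ((u - 1).factorial : ℝ) * (-1 / a) ^ (m - u) := by
  induction m with
  | zero =>
    simp only [pow_zero, one_mul]
    rw [integral_Ioi_exp_neg_mul_div ha]
    simp
  | succ m ih =>
    have h : ∫ y in Set.Ioi 0, a / (1 + a * y) * (y ^ (m + 1) * Real.exp (-y)) =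
        m.factorial - 1 / a * ∫ y in Set.Ioi 0, a / (1 + a * y) * (y ^ m * Real.exp (-y)) := by
      rw [← integral_pow_mul_exp_neg m, ← integral_const_mul,
        ← integral_sub (integrableOn_pow_mul_exp_neg m)
          ((integrableOn_div_mul_pow_mul_exp_neg ha m).const_mul _)]
      refine setIntegral_congr_fun measurableSet_Ioi fun y (hy : 0 < y) => ?_
      have : 1 + a * y ≠ 0 := by positivity
      field_simp
      ring
    -- The old terms acquire the factor `-1/a`; the new top term `u = m + 1` is the `m!` of the
    -- recursion.
    have hs : ∑ u ∈ Finset.Icc 1 m, ((u - 1).factorial : ℝ) * (-1 / a) ^ (m + 1 - u) =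
        -1 / a * ∑ u ∈ Finset.Icc 1 m, ((u - 1).factorial : ℝ) * (-1 / a) ^ (m - u) := by
      rw [Finset.mul_sum]
      refine Finset.sum_congr rfl fun u hu => ?_
      rw [Nat.succ_sub (Finset.mem_Icc.1 hu).2, pow_succ]
      ring
    rw [h, ih, Finset.sum_Icc_succ_top (by omega), hs]
    simp only [Nat.add_sub_cancel, Nat.sub_self, pow_zero, pow_succ]
    field_simp
    ring

/-- The differentiated function is the Erlang tail probability for `y ≥ 0`; its derivative
telescopes to minus the density. -/
theorem hasDerivAt_sum_pow_div_factorial_mul_exp_neg (n : ℕ) (y : ℝ) :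
    HasDerivAt (fun y : ℝ => (∑ m ∈ Finset.range (n + 1), y ^ m / m.factorial) * Real.exp (-y))
      (-(y ^ n / n.factorial * Real.exp (-y))) y := by
  induction n with
  | zero => simpa using (hasDerivAt_neg y).exp
  | succ n ih =>
    have h := ((hasDerivAt_pow (n + 1) y).div_const ((n + 1).factorial : ℝ)).mul
      (hasDerivAt_neg y).exp
    refine ((ih.add h).congr_deriv ?_).congr_of_eventuallyEq
      (Filter.Eventually.of_forall fun y => ?_)
    · have := n.factorial_ne_zero
      simp only [Nat.factorial_succ, Nat.add_sub_cancel]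
      push_cast
      field_simp
      ring
    · simp only [Finset.sum_range_succ _ (n + 1), Pi.add_apply, Pi.mul_apply]
      ring

theorem abs_log_one_add_le {x : ℝ} (hx : 0 ≤ x) : |Real.log (1 + x)| ≤ x := by
  rw [abs_of_nonneg (Real.log_nonneg (by linarith))]
  linarith [Real.log_le_sub_one_of_pos (show 0 < 1 + x by linarith)]

/-- Integration by parts with the tail `S`: the boundary terms vanish at `0` because `log 1 = 0` and
at infinity by exponential decay. What remains is the integral of `a/(1 + a y) S`, a finite sum of
known integrals. -/
theorem integral_log_one_add_mul_erlang {a : ℝ} (ha : 0 < a) (n : ℕ) :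
    ∫ y, Real.log (1 + a * y) ∂(erlang n) =
      ∑ m ∈ Finset.range (n + 1), 1 / (m.factorial : ℝ) *
        ((-1) ^ (m + 1) * Real.exp (1 / a) / a ^ m * Ei (-1 / a) +
          ∑ u ∈ Finset.Icc 1 m, ((u - 1).factorial : ℝ) * (-1 / a) ^ (m - u)) := by
  let S : ℝ → ℝ := fun y => (∑ m ∈ Finset.range (n + 1), y ^ m / m.factorial) * Real.exp (-y)
  have hS : ∀ y, S y = (∑ m ∈ Finset.range (n + 1), y ^ m / m.factorial) * Real.exp (-y) :=
    fun _ => rfl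
  let F : ℝ → ℝ := fun y => a / (1 + a * y) * S y
  let G : ℝ → ℝ := fun y => (y ^ n / n.factorial * Real.exp (-y)) * Real.log (1 + a * y)
  have hFsum : F = fun y => ∑ m ∈ Finset.range (n + 1),
      1 / (m.factorial : ℝ) * (a / (1 + a * y) * (y ^ m * Real.exp (-y))) := by
    ext y
    simp only [F, hS, Finset.sum_mul, Finset.mul_sum]
    exact Finset.sum_congr rfl fun m _ => by ring
  have hterm : ∀ m ∈ Finset.range (n + 1), IntegrableOn (fun y : ℝ =>
      1 / (m.factorial : ℝ) * (a / (1 + a * y) * (y ^ m * Real.exp (-y)))) (Set.Ioi 0) :=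
    fun m _ => (integrableOn_div_mul_pow_mul_exp_neg ha m).const_mul _
  have hF : IntegrableOn F (Set.Ioi 0) := by
    rw [hFsum]
    exact integrable_finsetSum _ hterm
  have hG : IntegrableOn G (Set.Ioi 0) := by
    refine ((integrableOn_pow_mul_exp_neg (n + 1)).const_mul (a / n.factorial)).mono'
      (by fun_prop) ?_
    filter_upwards [ae_restrict_mem measurableSet_Ioi] with y (hy : 0 < y)
    rw [Real.norm_eq_abs, abs_mul, abs_of_nonneg (by positivity)]
    calc _ ≤ y ^ n / n.factorial * Real.exp (-y) * (a * y) := by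
          gcongr
          exact abs_log_one_add_le (by positivity)
      _ = _ := by ring
  have hd : ∀ y ∈ Set.Ioi (0 : ℝ), HasDerivAt (fun y => Real.log (1 + a * y) * S y)
      (F y - G y) y := by
    intro y (hy : 0 < y)
    have h1 : HasDerivAt (fun y => Real.log (1 + a * y)) (a / (1 + a * y)) y := by
      simpa using (((hasDerivAt_id y).const_mul a).const_add 1).log
        (show 1 + a * id y ≠ 0 by simp only [id]; positivity)
    refine (h1.mul (hasDerivAt_sum_pow_div_factorial_mul_exp_neg n y)).congr_deriv ?_
    simp only [F, G, hS]
    ring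
  have hlim : Filter.Tendsto (fun y => Real.log (1 + a * y) * S y) Filter.atTop (nhds 0) := by
    have hb : Filter.Tendsto (fun y : ℝ => ∑ m ∈ Finset.range (n + 1),
        a / m.factorial * (y ^ (m + 1) * Real.exp (-y))) Filter.atTop (nhds 0) := by
      simpa using tendsto_finsetSum (Finset.range (n + 1)) fun m _ =>
        (Real.tendsto_pow_mul_exp_neg_atTop_nhds_zero (m + 1)).const_mul (a / m.factorial)
    refine squeeze_zero_norm' ?_ hb
    filter_upwards [Filter.eventually_gt_atTop 0] with y hy
    have hS0 : 0 ≤ S y := by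
      rw [hS]
      positivity
    rw [Real.norm_eq_abs, abs_mul, abs_of_nonneg hS0]
    calc _ ≤ a * y * S y := by
          gcongr
          exact abs_log_one_add_le (by positivity)
      _ = _ := by
          simp only [hS, Finset.sum_mul, Finset.mul_sum]
          exact Finset.sum_congr rfl fun m _ => by ring
  have hc : ContinuousWithinAt (fun y => Real.log (1 + a * y) * S y) (Set.Ici 0) 0 := by
    have hScont : Continuous S := by
      simp only [S]
      fun_prop
    exact (ContinuousAt.mul (ContinuousAt.log (by fun_prop) (by simp))
      hScont.continuousAt).continuousWithinAt
  have hmain := integral_Ioi_of_hasDerivAt_of_tendsto hc hd (hF.sub hG) hlim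
  rw [integral_sub hF hG] at hmain
  simp only [mul_zero, add_zero, Real.log_one, zero_mul, sub_zero] at hmain
  rw [integral_erlang]
  simp only [smul_eq_mul]
  rw [← sub_eq_zero.1 hmain, hFsum, integral_finsetSum _ hterm]
  refine Finset.sum_congr rfl fun m _ => ?_
  rw [integral_const_mul, integral_Ioi_div_mul_pow_mul_exp_neg ha]

/-! ### The generating function of complete homogeneous symmetric functions. -/

section GeometricProduct

variable {ι : Type*} (q : ι → ℝ) (s : Finset ι)

/-- The power series `∏ 1 / (1 - q_j X)`, whose coefficients are the complete homogeneous symmetric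
functions of the `q_j`. -/
def geomProd : PowerSeries ℝ := ∏ j ∈ s, PowerSeries.mk fun n => q j ^ n

/-- The logarithmic derivative of `∏ (1 - q_j X)⁻¹` is `∑ q_j/(1 - q_j X)`, the generating function
of the power sums. -/
theorem derivative_geomProd :
    PowerSeries.derivative ℝ (geomProd q s) =
      geomProd q s * PowerSeries.mk fun n => ∑ j ∈ s, q j ^ (n + 1) := by
  classical
  induction s using Finset.induction_on with
  | empty =>
    ext n
    simp [geomProd]
  | insert i s hi ih =>
    have hgeom : PowerSeries.derivative ℝ (PowerSeries.mk fun n => q i ^ n) =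
        (PowerSeries.mk fun n => q i ^ n) * PowerSeries.mk fun n => q i ^ (n + 1) := by
      ext n
      rw [PowerSeries.coeff_derivative, PowerSeries.coeff_mul, PowerSeries.coeff_mk,
        Finset.sum_congr rfl (g := fun _ => q i ^ (n + 1)) fun x hx => ?_]
      · simp [mul_comm]
      · rw [PowerSeries.coeff_mk, PowerSeries.coeff_mk, ← pow_add, ← add_assoc,
          Finset.HasAntidiagonal.mem_antidiagonal.1 hx]
    have hadd : (PowerSeries.mk fun n => ∑ j ∈ insert i s, q j ^ (n + 1)) =
        (PowerSeries.mk fun n => q i ^ (n + 1)) +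
          PowerSeries.mk fun n => ∑ j ∈ s, q j ^ (n + 1) := by
      ext n
      simp [Finset.sum_insert hi]
    have hins : geomProd q (insert i s) = (PowerSeries.mk fun n => q i ^ n) * geomProd q s :=
      Finset.prod_insert hi
    rw [hins, Derivation.leibniz, ih, hgeom, hadd, smul_eq_mul, smul_eq_mul]
    ring

theorem coeff_zero_geomProd : PowerSeries.coeff 0 (geomProd q s) = 1 := by
  simp [geomProd, map_prod]

/-- Newton's identity, read off from the coefficient of `X^k` in `derivative_geomProd`; it has the
shape of the recursion for `psi`. -/
theorem coeff_succ_geomProd (k : ℕ) :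
    PowerSeries.coeff (k + 1) (geomProd q s) = ∑ i ∈ Finset.Icc 1 (k + 1),
      (∑ j ∈ s, q j ^ i) * (PowerSeries.coeff (k + 1 - i) (geomProd q s) / ((k : ℝ) + 1)) := by
  have h := congrArg (PowerSeries.coeff k) (derivative_geomProd q s)
  rw [PowerSeries.coeff_derivative, mul_comm (geomProd q s), PowerSeries.coeff_mul,
    Finset.Nat.sum_antidiagonal_eq_sum_range_succ_mk] at h
  have hk : (k : ℝ) + 1 ≠ 0 := by positivity
  rw [← eq_div_iff hk] at h
  rw [h, Finset.sum_div, Finset.range_eq_Ico,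
    show Finset.Icc 1 (k + 1) = Finset.Ico (0 + 1) (k + 1 + 1) from rfl, ← Finset.sum_Ico_add']
  refine Finset.sum_congr rfl fun i _ => ?_
  rw [PowerSeries.coeff_mk, Nat.add_sub_add_right, mul_div_assoc]

variable {q s}

theorem coeff_geomProd_nonneg (hq : ∀ j ∈ s, 0 ≤ q j) (k : ℕ) :
    0 ≤ PowerSeries.coeff k (geomProd q s) := by
  induction k using Nat.strong_induction_on with
  | _ k ih =>
    cases k with
    | zero => simp [coeff_zero_geomProd]
    | succ k =>
      rw [coeff_succ_geomProd]
      refine Finset.sum_nonneg fun i hi => mul_nonneg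
        (Finset.sum_nonneg fun j hj => pow_nonneg (hq j hj) _) (div_nonneg (ih _ ?_) (by positivity))
      have := Finset.mem_Icc.1 hi
      omega

/-- A Cauchy product of geometric series. Strictness of `q_j < 1` admits the whole closed disc: `z =
1` gives summability of `psi`, and `z = (1 - it)⁻¹` gives the characteristic function. -/
theorem summable_and_tsum_geomProd (hq : ∀ j ∈ s, 0 ≤ q j) (hq1 : ∀ j ∈ s, q j < 1) {z : ℂ}
    (hz : ‖z‖ ≤ 1) :
    Summable (fun k => ‖((PowerSeries.coeff k (geomProd q s) : ℝ) : ℂ) * z ^ k‖) ∧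
      ∑' k, ((PowerSeries.coeff k (geomProd q s) : ℝ) : ℂ) * z ^ k = ∏ j ∈ s, (1 - q j * z)⁻¹ := by
  classical
  induction s using Finset.induction_on with
  | empty =>
    have h : ∀ k ≠ 0, ((PowerSeries.coeff k (geomProd q ∅) : ℝ) : ℂ) * z ^ k = 0 := fun k hk => by
      simp [geomProd, PowerSeries.coeff_one, hk]
    refine ⟨summable_of_ne_finset_zero (s := {0}) fun k hk => ?_, ?_⟩
    · rw [h k (by simpa using hk), norm_zero]
    · rw [tsum_eq_single 0 h]
      simp [coeff_zero_geomProd]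
  | insert i s hi ih =>
    obtain ⟨hs, ht⟩ := ih (fun j hj => hq j (Finset.mem_insert_of_mem hj))
      (fun j hj => hq1 j (Finset.mem_insert_of_mem hj))
    have hqz : ‖(q i : ℂ) * z‖ < 1 := by
      rw [norm_mul, Complex.norm_real, Real.norm_of_nonneg (hq i (Finset.mem_insert_self i s))]
      exact (mul_le_of_le_one_right (hq i (Finset.mem_insert_self i s)) hz).trans_lt
        (hq1 i (Finset.mem_insert_self i s))
    have hg : Summable fun n => ‖((q i : ℂ) * z) ^ n‖ := by
      simpa using summable_geometric_of_norm_lt_one (x := ‖(q i : ℂ) * z‖) (by simpa using hqz)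
    have hcoeff : ∀ k, ((PowerSeries.coeff k (geomProd q (insert i s)) : ℝ) : ℂ) * z ^ k =
        ∑ x ∈ Finset.HasAntidiagonal.antidiagonal k, ((q i : ℂ) * z) ^ x.1 *
          (((PowerSeries.coeff x.2 (geomProd q s) : ℝ) : ℂ) * z ^ x.2) := by
      intro k
      rw [show geomProd q (insert i s) = (PowerSeries.mk fun n => q i ^ n) * geomProd q s from
        Finset.prod_insert hi, PowerSeries.coeff_mul, Complex.ofReal_sum, Finset.sum_mul]
      refine Finset.sum_congr rfl fun x hx => ?_
      rw [PowerSeries.coeff_mk, ← Finset.HasAntidiagonal.mem_antidiagonal.1 hx]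
      push_cast
      ring
    refine ⟨(summable_norm_sum_mul_antidiagonal_of_summable_norm hg hs).congr
      fun k => by rw [hcoeff k], ?_⟩
    rw [tsum_congr hcoeff, ← tsum_mul_tsum_eq_tsum_sum_antidiagonal_of_summable_norm hg hs,
      ht, tsum_geometric_of_norm_lt_one hqz, Finset.prod_insert hi]

end GeometricProduct

/-! ### The coefficients `ψ_k`: nonnegativity, summability, generating function. -/

theorem psi_eq_coeff_geomProd (hR : R.IsHermitian) (k : ℕ) :
    psi hR k = PowerSeries.coeff k
      (geomProd (fun j => 1 - lambdaMin hR / hR.eigenvalues j) (posEig hR)) := by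
  induction k using Nat.strong_induction_on with
  | _ k ih =>
    cases k with
    | zero => rw [psi_zero, coeff_zero_geomProd]
    | succ k =>
      rw [psi_succ, coeff_succ_geomProd]
      refine Finset.sum_congr rfl fun i hi => ?_
      have := Finset.mem_Icc.1 hi
      rw [ih (k + 1 - i) (by omega)]

theorem eigenvalue_pos_of_mem_posEig (hR : R.IsHermitian) {j : Fin N} (hj : j ∈ posEig hR) :
    0 < hR.eigenvalues j :=
  (Finset.mem_filter.1 hj).2

theorem lambdaMin_le_of_mem_posEig (hR : R.IsHermitian) {j : Fin N} (hj : j ∈ posEig hR) :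
    lambdaMin hR ≤ hR.eigenvalues j :=
  (isLeast_lambdaMin hR ⟨j, hj⟩).2 ⟨j, hj, rfl⟩

theorem lambdaMin_pos (hR : R.IsHermitian) (h : (posEig hR).Nonempty) : 0 < lambdaMin hR := by
  obtain ⟨j, hj, hj'⟩ := (isLeast_lambdaMin hR h).1
  rw [← hj']
  exact eigenvalue_pos_of_mem_posEig hR hj

theorem one_sub_lambdaMin_div_nonneg (hR : R.IsHermitian) {j : Fin N} (hj : j ∈ posEig hR) :
    0 ≤ 1 - lambdaMin hR / hR.eigenvalues j := by
  rw [sub_nonneg, div_le_one (eigenvalue_pos_of_mem_posEig hR hj)]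
  exact lambdaMin_le_of_mem_posEig hR hj

theorem one_sub_lambdaMin_div_lt_one (hR : R.IsHermitian) {j : Fin N} (hj : j ∈ posEig hR) :
    1 - lambdaMin hR / hR.eigenvalues j < 1 :=
  sub_lt_self 1 (div_pos (lambdaMin_pos hR ⟨j, hj⟩) (eigenvalue_pos_of_mem_posEig hR hj))

theorem psi_nonneg (hR : R.IsHermitian) (k : ℕ) : 0 ≤ psi hR k := by
  rw [psi_eq_coeff_geomProd]
  exact coeff_geomProd_nonneg (fun j hj => one_sub_lambdaMin_div_nonneg hR hj) k

theorem summable_psi (hR : R.IsHermitian) : Summable (psi hR) := by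
  have h := (summable_and_tsum_geomProd (fun j hj => one_sub_lambdaMin_div_nonneg hR hj)
    (fun j hj => one_sub_lambdaMin_div_lt_one hR hj) (z := 1) (by simp)).1
  refine h.congr fun k => ?_
  rw [← psi_eq_coeff_geomProd, one_pow, mul_one, Complex.norm_real,
    Real.norm_of_nonneg (psi_nonneg hR k)]

theorem tsum_psi_mul_pow (hR : R.IsHermitian) {z : ℂ} (hz : ‖z‖ ≤ 1) :
    ∑' k, (psi hR k : ℂ) * z ^ k =
      ∏ j ∈ posEig hR, (1 - (1 - lambdaMin hR / hR.eigenvalues j : ℝ) * z)⁻¹ := by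
  simp_rw [psi_eq_coeff_geomProd]
  exact (summable_and_tsum_geomProd (fun j hj => one_sub_lambdaMin_div_nonneg hR hj)
    (fun j hj => one_sub_lambdaMin_div_lt_one hR hj) hz).2

/-! ### The Erlang mixture and its identification with the rescaled law of `‖h‖²`. -/

/-- The normalising constant `λ_min ^ r / ∏ λ_i`. -/
def mixConst (hR : R.IsHermitian) : ℝ :=
  lambdaMin hR ^ R.rank / ∏ j ∈ posEig hR, hR.eigenvalues j

/-- The mixture of Erlang distributions with weights proportional to `ψ_k`. -/
def erlangMixture (hR : R.IsHermitian) : Measure ℝ :=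
  Measure.sum fun k => ENNReal.ofReal (mixConst hR * psi hR k) • erlang (R.rank + k - 1)

theorem mixConst_pos (hR : R.IsHermitian) (h : (posEig hR).Nonempty) : 0 < mixConst hR :=
  div_pos (pow_pos (lambdaMin_pos hR h) _)
    (Finset.prod_pos fun _ hj => eigenvalue_pos_of_mem_posEig hR hj)

theorem isFiniteMeasure_erlangMixture (hR : R.IsHermitian) :
    IsFiniteMeasure (erlangMixture hR) := by
  refine ⟨?_⟩
  rw [erlangMixture, Measure.sum_apply _ MeasurableSet.univ]
  simp only [Measure.smul_apply, measure_univ, smul_eq_mul, mul_one]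
  exact ((summable_psi hR).mul_left _).tsum_ofReal_lt_top

theorem norm_inv_one_sub_mul_I_le_one (t : ℝ) : ‖(1 - t * Complex.I : ℂ)⁻¹‖ ≤ 1 := by
  rw [norm_inv]
  refine inv_le_one_of_one_le₀ ?_
  simpa using Complex.abs_re_le_norm (1 - t * Complex.I : ℂ)

theorem integral_smul_erlang {E : Type*} [NormedAddCommGroup E] [NormedSpace ℝ E]
    (hR : R.IsHermitian) (h : (posEig hR).Nonempty) (k n : ℕ) (g : ℝ → E) :
    ∫ y, g y ∂(ENNReal.ofReal (mixConst hR * psi hR k) • erlang n) =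
      (mixConst hR * psi hR k) • ∫ y, g y ∂(erlang n) := by
  rw [integral_smul_measure,
    ENNReal.toReal_ofReal (mul_nonneg (mixConst_pos hR h).le (psi_nonneg hR k))]

theorem charFun_erlangMixture (hR : R.PosSemidef) (h : (posEig hR.isHermitian).Nonempty) (t : ℝ) :
    charFun (erlangMixture hR.isHermitian) t =
      ∏ j ∈ posEig hR.isHermitian,
        (1 - ((lambdaMin hR.isHermitian)⁻¹ * t : ℝ) * Complex.I *
          hR.isHermitian.eigenvalues j)⁻¹ := by
  have := isFiniteMeasure_erlangMixture hR.isHermitian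
  -- Positive rank makes the natural-number subtraction in `R.rank + k - 1` exact, so the component
  -- has shape `R.rank + k`.
  have hr : 0 < R.rank := by rw [← card_posEig hR]; exact h.card_pos
  have hint : Integrable (fun x : ℝ => Complex.exp (t * x * Complex.I))
      (erlangMixture hR.isHermitian) := by
    refine Integrable.of_bound (by fun_prop) 1 (Filter.Eventually.of_forall fun x => ?_)
    rw [← Complex.ofReal_mul, Complex.norm_exp_ofReal_mul_I]
  have hβ := lambdaMin_pos hR.isHermitian h
  set z : ℂ := (1 - t * Complex.I)⁻¹ with hz
  have hden : (1 - t * Complex.I : ℂ) ≠ 0 := fun h0 => by simpa using congrArg Complex.re h0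
  have hterm : ∀ k, ∫ x : ℝ, Complex.exp (t * x * Complex.I)
      ∂(ENNReal.ofReal (mixConst hR.isHermitian * psi hR.isHermitian k) •
        erlang (R.rank + k - 1)) =
      mixConst hR.isHermitian * z ^ R.rank * (psi hR.isHermitian k * z ^ k) := by
    intro k
    rw [integral_smul_erlang _ h, ← charFun_apply_real, charFun_erlang,
      show R.rank + k - 1 + 1 = R.rank + k by omega, pow_add, Complex.real_smul]
    push_cast
    ring
  rw [charFun_apply_real, erlangMixture, ← (hasSum_integral_measure hint).tsum_eq]
  simp_rw [hterm]
  rw [tsum_mul_left, tsum_psi_mul_pow _ (norm_inv_one_sub_mul_I_le_one t), mixConst,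
    ← card_posEig hR, Complex.ofReal_div, Complex.ofReal_pow, Complex.ofReal_prod,
    div_mul_eq_mul_div, ← mul_pow, ← Finset.prod_const, ← Finset.prod_div_distrib,
    ← Finset.prod_mul_distrib]
  refine Finset.prod_congr rfl fun j hj => ?_
  have hj0 : (hR.isHermitian.eigenvalues j : ℂ) ≠ 0 := by
    exact_mod_cast (eigenvalue_pos_of_mem_posEig hR.isHermitian hj).ne'
  have hβ0 : (lambdaMin hR.isHermitian : ℂ) ≠ 0 := by exact_mod_cast hβ.ne'
  -- From `z⁻¹ = 1 - it`: `z⁻¹ - (1 - β/λ) = β/λ - it = (β/λ)(1 - itλ/β)`. The prefactor `(β/λ) z`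
  -- cancels one factor of `mixConst * z ^ r`.
  have key : (1 - ((1 - lambdaMin hR.isHermitian / hR.isHermitian.eigenvalues j : ℝ) : ℂ) * z) =
      lambdaMin hR.isHermitian / hR.isHermitian.eigenvalues j * z *
        (1 - ((lambdaMin hR.isHermitian)⁻¹ * t : ℝ) * Complex.I *
          hR.isHermitian.eigenvalues j) := by
    rw [hz]
    push_cast
    field_simp
    ring
  rw [key, mul_inv, ← mul_assoc]
  have hz0 : z ≠ 0 := inv_ne_zero hden
  rw [mul_div_right_comm, mul_inv_cancel₀ (mul_ne_zero (div_ne_zero hβ0 hj0) hz0), one_mul]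

/-- Moschopoulos' expansion: the normalised law of `‖h‖²` is a mixture of Erlang distributions. -/
theorem map_inv_lambdaMin_mul_norm_sq (hR : R.PosSemidef) (h : (posEig hR.isHermitian).Nonempty) :
    ((complexGaussian 0 R).map (fun z => ‖z‖ ^ 2)).map
      (fun x => (lambdaMin hR.isHermitian)⁻¹ * x) = erlangMixture hR.isHermitian := by
  have := isFiniteMeasure_erlangMixture hR.isHermitian
  have : IsFiniteMeasure (complexGaussian 0 R) := by
    rw [complexGaussian]
    infer_instance
  refine Measure.ext_of_charFun (funext fun t => ?_)
  rw [charFun_map_mul, charFun_map_norm_sq_complexGaussian hR, charFun_erlangMixture hR h]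

/-! ### Termwise integration of the capacity. -/

theorem eccTerm_eq_integral_erlang (hR : R.PosSemidef) (h : (posEig hR.isHermitian).Nonempty)
    {p σ : ℝ} (hp : 0 < p) (hσ : 0 < σ) (k : ℕ) :
    eccTerm hR.isHermitian p σ k = psi hR.isHermitian k *
      ∫ y, Real.logb 2 (1 + p / σ ^ 2 * lambdaMin hR.isHermitian * y)
        ∂(erlang (R.rank + k - 1)) := by
  have hr : 0 < R.rank := by rw [← card_posEig hR]; exact h.card_pos
  have ha : 0 < p / σ ^ 2 * lambdaMin hR.isHermitian :=
    mul_pos (by positivity) (lambdaMin_pos hR.isHermitian h)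
  simp only [Real.logb]
  -- The summation index is reversed by `m = r + k - 1 - μ`.
  rw [integral_div, integral_log_one_add_mul_erlang ha,
    show R.rank + k - 1 + 1 = R.rank + k by omega, ← Finset.sum_range_reflect, eccTerm,
    Finset.sum_div, Finset.mul_sum]
  refine Finset.sum_congr rfl fun m hm => ?_
  have hm' := Finset.mem_range.1 hm
  rw [show R.rank + k - m = R.rank + k - 1 - m + 1 by omega]
  ring

theorem abs_logb_two_one_add_le {x : ℝ} (hx : 0 ≤ x) :
    |Real.logb 2 (1 + x)| ≤ (Real.log 2)⁻¹ * x := by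
  have h2 : 0 < Real.log 2 := Real.log_pos one_lt_two
  rw [Real.logb, abs_div, abs_of_pos h2, div_eq_inv_mul]
  gcongr
  exact abs_log_one_add_le hx

theorem measurable_logb_two_one_add_mul (c : ℝ) :
    Measurable fun x => Real.logb 2 (1 + c * x) := by
  simp only [Real.logb]
  fun_prop

theorem integrable_logb_map_norm_sq (hR : R.PosSemidef) {c : ℝ} (hc : 0 ≤ c) :
    Integrable (fun x => Real.logb 2 (1 + c * x))
      ((complexGaussian 0 R).map (fun z => ‖z‖ ^ 2)) := by
  have hpos : ∀ᵐ x ∂((complexGaussian 0 R).map (fun z => ‖z‖ ^ 2)), 0 ≤ x := by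
    rw [ae_map_iff (by fun_prop) measurableSet_Ici]
    exact Filter.Eventually.of_forall fun z => by positivity
  refine ((integrable_id_map_norm_sq_complexGaussian hR).const_mul ((Real.log 2)⁻¹ * c)).mono'
    (measurable_logb_two_one_add_mul c).aestronglyMeasurable ?_
  filter_upwards [hpos] with x hx
  rw [Real.norm_eq_abs, mul_assoc]
  exact abs_logb_two_one_add_le (mul_nonneg hc hx)

/-- Integrability against the sum measure justifies the interchange of sum and integral; it is
transported from the law of `‖h‖²`, so no bound on `eccTerm` is needed. -/
theorem hasSum_eccTerm_of_nonempty (hR : R.PosSemidef) (h : (posEig hR.isHermitian).Nonempty)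
    {p σ : ℝ} (hp : 0 < p) (hσ : 0 < σ) :
    HasSum (fun k => mixConst hR.isHermitian * eccTerm hR.isHermitian p σ k)
      (∫ x, Real.logb 2 (1 + p / σ ^ 2 * x)
        ∂((complexGaussian 0 R).map (fun z => ‖z‖ ^ 2))) := by
  have hβ := (lambdaMin_pos hR.isHermitian h).ne'
  have hcomp : ∀ x, Real.logb 2 (1 + p / σ ^ 2 * lambdaMin hR.isHermitian *
      ((lambdaMin hR.isHermitian)⁻¹ * x)) = Real.logb 2 (1 + p / σ ^ 2 * x) := fun x => by
    rw [mul_assoc, mul_inv_cancel_left₀ hβ]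
  have hmeas := measurable_logb_two_one_add_mul (p / σ ^ 2 * lambdaMin hR.isHermitian)
  have hint : Integrable (fun y => Real.logb 2 (1 + p / σ ^ 2 * lambdaMin hR.isHermitian * y))
      (erlangMixture hR.isHermitian) := by
    rw [← map_inv_lambdaMin_mul_norm_sq hR h,
      integrable_map_measure hmeas.aestronglyMeasurable (by fun_prop)]
    exact (integrable_logb_map_norm_sq hR (by positivity)).congr
      (Filter.Eventually.of_forall fun x => (hcomp x).symm)
  have hsum := hasSum_integral_measure hint
  rw [← erlangMixture, ← map_inv_lambdaMin_mul_norm_sq hR h,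
    integral_map (by fun_prop) hmeas.aestronglyMeasurable] at hsum
  simp_rw [hcomp] at hsum
  refine hsum.congr_fun fun k => ?_
  rw [integral_smul_erlang _ h, eccTerm_eq_integral_erlang hR h hp hσ, smul_eq_mul, mul_assoc]

/-! ### The degenerate case `R = 0` and the conclusion. -/

theorem posEig_eq_empty_iff_rank (hR : R.PosSemidef) :
    posEig hR.isHermitian = ∅ ↔ R.rank = 0 := by
  rw [← card_posEig hR, Finset.card_eq_zero]

theorem eccTerm_eq_zero_of_rank_eq_zero (hR : R.PosSemidef) (h : R.rank = 0) (p σ : ℝ) :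
    eccTerm hR.isHermitian p σ = 0 := by
  ext k
  cases k with
  -- For `k = 0` the range of `μ` is empty; for later `k` the coefficient `ψ_k` vanishes as an empty
  -- sum of powers.
  | zero => simp [eccTerm, h]
  | succ k =>
    have hpsi : psi hR.isHermitian (k + 1) = 0 := by
      rw [psi_succ, (posEig_eq_empty_iff_rank hR).2 h]
      simp
    simp [eccTerm, hpsi]

theorem map_norm_sq_complexGaussian_of_rank_eq_zero (hR : R.PosSemidef) (h : R.rank = 0) :
    (complexGaussian 0 R).map (fun z => ‖z‖ ^ 2) = Measure.dirac 0 := by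
  have h0 : ∀ j, hR.isHermitian.eigenvalues j = 0 := fun j => by
    have hj : j ∉ posEig hR.isHermitian := by simp [(posEig_eq_empty_iff_rank hR).2 h]
    exact le_antisymm (not_lt.1 fun hlt => hj (by simpa [posEig] using hlt))
      (hR.eigenvalues_nonneg j)
  rw [map_norm_sq_complexGaussian hR]
  simp [h0, Measure.map_const]

end RayleighECC

end

theorem mainTheorem6 {Ω : Type*} [MeasurableSpace Ω] (P : Measure Ω) [IsProbabilityMeasure P]
    (N : ℕ) (R : Matrix (Fin N) (Fin N) ℂ) (hR : R.PosSemidef)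
    (h : Ω → EuclideanSpace ℂ (Fin N)) (hh : HasLaw h (RayleighECC.complexGaussian 0 R) P)
    (p σ : ℝ) (hp : 0 < p) (hσ : 0 < σ) :
    Integrable (fun ω => Real.logb 2 (1 + p / σ ^ 2 * ‖h ω‖ ^ 2)) P ∧
    Summable (RayleighECC.eccTerm hR.isHermitian p σ) ∧
    ∫ ω, Real.logb 2 (1 + p / σ ^ 2 * ‖h ω‖ ^ 2) ∂P =
      RayleighECC.lambdaMin hR.isHermitian ^ R.rank /
          (∏ j ∈ RayleighECC.posEig hR.isHermitian, hR.isHermitian.eigenvalues j) *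
        ∑' k : ℕ, RayleighECC.eccTerm hR.isHermitian p σ k := by
  have hmap : (RayleighECC.complexGaussian 0 R).map (fun z => ‖z‖ ^ 2) =
      P.map (fun ω => ‖h ω‖ ^ 2) := by
    rw [← hh.map_eq, AEMeasurable.map_map_of_aemeasurable (by fun_prop) hh.aemeasurable]
    rfl
  have hm : AEMeasurable (fun ω => ‖h ω‖ ^ 2) P := hh.aemeasurable.norm.pow_const 2
  have hmeas := RayleighECC.measurable_logb_two_one_add_mul (p / σ ^ 2)
  have hint := RayleighECC.integrable_logb_map_norm_sq hR (c := p / σ ^ 2) (by positivity)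
  rw [hmap, integrable_map_measure hmeas.aestronglyMeasurable hm] at hint
  have hE : ∫ ω, Real.logb 2 (1 + p / σ ^ 2 * ‖h ω‖ ^ 2) ∂P =
      ∫ x, Real.logb 2 (1 + p / σ ^ 2 * x)
        ∂((RayleighECC.complexGaussian 0 R).map (fun z => ‖z‖ ^ 2)) := by
    rw [hmap, integral_map hm hmeas.aestronglyMeasurable]
  refine ⟨hint, ?_⟩
  rw [hE]
  rcases (RayleighECC.posEig hR.isHermitian).eq_empty_or_nonempty with h0 | h0
  · have hr := (RayleighECC.posEig_eq_empty_iff_rank hR).1 h0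
    rw [RayleighECC.map_norm_sq_complexGaussian_of_rank_eq_zero hR hr,
      RayleighECC.eccTerm_eq_zero_of_rank_eq_zero hR hr]
    exact ⟨summable_zero, by simp⟩
  · have hs := RayleighECC.hasSum_eccTerm_of_nonempty hR h0 hp hσ
    exact ⟨(summable_mul_left_iff (RayleighECC.mixConst_pos hR.isHermitian h0).ne').1 hs.summable,
      by rw [← hs.tsum_eq, tsum_mul_left, RayleighECC.mixConst]⟩
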